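/- Let $n\ge 0$ be an integer and let $M$ be a smooth manifold of dimension $2n+1$. Let $(\phi,\xi,\eta,g)$ be a Kenmotsu structure on $M$, that is: $g$ is a Riemannian metric, $\phi$ a smooth $(1,1)$-tensor field, $\xi$ a smooth vector field and $\eta$ a smooth $1$-form with $$\phi^2=-I+\eta\otimes\xi,\qquad \eta(\xi)=1,\qquad \eta=g(\xi,\cdot),\qquad g(\phi\,\cdot,\phi\,\cdot)=g-\eta\otimes\eta,$$ and the Levi-Civita connection $\nabla$ of $g$ satisfies $(\nabla_X\phi)Y=g(\phi X,Y)\xi-\eta(Y)\phi X$ for all vector fields $X,Y$. Let $a>0$ be a real constant and let $$\overline{\phi}=\phi,\qquad \overline{\xi}=\tfrac1a\xi,\qquad \overline{\eta}=a\eta,\qquad \overline{g}=a\,g+a(a-1)\,\eta\otimes\eta$$ be the $D$-homothetically deformed structure. Let $V$ be a smooth vector field and $\overline{\lambda}$ a smooth function on $M$ such that $(V,\overline{\lambda})$ is an almost Ricci soliton for $\overline{g}$, i.e. $\frac12\pounds_V\overline{g}+\overline{\mathrm{Ric}}=\overline{\lambda}\,\overline{g}$, where $\overline{\mathrm{Ric}}$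 is the Ricci tensor of $\overline{g}$, and assume that $V$ is solenoidal, i.e. its divergence with respect to $\overline{g}$ vanishes. Then, with $\mathrm{Ric}$ and $\mathrm{scal}$ the Ricci tensor and the scalar curvature of $g$, $$\overline{\lambda}=\xi(\eta(V))-\frac{2n}{a^2},$$ $$\begin{aligned}\mathrm{Ric}(X,Y)={}&[a\,\xi(\eta(V))-2n]\,g(X,Y)+a(a-1)\,\xi(\eta(V))\,\eta(X)\eta(Y)-\frac a2\,[g(\nabla_XV,Y)+g(\nabla_YV,X)]\\&-\frac{a(a-1)}2\,\{\eta(X)[\eta(\nabla_YV)+g(Y,V)]+\eta(Y)[\eta(\nabla_XV)+g(X,V)]-2\eta(X)\eta(Y)\eta(V)\}\end{aligned}$$ for all $X,Y$, and $$\mathrm{scal}=(2n+1)\,[a\,\xi(\eta(V))-2n].$$ -/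

import Mathlib

open scoped ContDiff Manifold

theorem AlmostContact.contMDiffAt_smulRight {E : Type*} [NormedAddCommGroup E] [NormedSpace ℝ E]
    {H : Type*} [TopologicalSpace H] {I : ModelWithCorners ℝ E H}
    {M : Type*} [TopologicalSpace M] [ChartedSpace H M] {A B : M → (E →L[ℝ] ℝ)} {x : M}
    (hA : ContMDiffAt I 𝓘(ℝ, E →L[ℝ] ℝ) ∞ A x) (hB : ContMDiffAt I 𝓘(ℝ, E →L[ℝ] ℝ) ∞ B x) :
    ContMDiffAt I 𝓘(ℝ, E →L[ℝ] E →L[ℝ] ℝ) ∞ (fun y ↦ (A y).smulRight (B y)) x := by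
  have h : ContDiff ℝ ∞ (fun p : (E →L[ℝ] ℝ) × (E →L[ℝ] ℝ) ↦
      ContinuousLinearMap.smulRightL ℝ E (E →L[ℝ] ℝ) p.1 p.2) := by fun_prop
  exact h.contDiffAt.contMDiffAt.comp x (hA.prodMk_space hB)

noncomputable section

open Bundle VectorField FiberBundle
open scoped Topology

namespace AlmostContact

variable {E : Type*} [NormedAddCommGroup E] [NormedSpace ℝ E] [FiniteDimensional ℝ E]
  {H : Type*} [TopologicalSpace H] {I : ModelWithCorners ℝ E H}
  {M : Type*} [TopologicalSpace M] [ChartedSpace H M] [IsManifold I ∞ M]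

variable (I M) in
/-- Smooth Riemannian metrics on `M`. -/
abbrev RiemMetric := ContMDiffRiemannianMetric I ∞ E (TangentSpace I : M → Type _)

/-- The directional derivative `X(f)` of a function along a vector field. -/
def dirDeriv (X : Π x : M, TangentSpace I x) (f : M → ℝ) (x : M) : ℝ :=
  mvfderiv I f x (X x)

/-- The function `g(X, Y)`. -/
def pairing (g : RiemMetric I M) (X Y : Π x : M, TangentSpace I x) (x : M) : ℝ :=
  g.inner x (X x) (Y x)

/-! ### The Levi-Civita connection -/

/-- Half of the right-hand side of the Koszul formula, so that `g(∇_X Y, Z) = koszul g Y X Z`. -/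
def koszul (g : RiemMetric I M) (Y X Z : Π x : M, TangentSpace I x) (x : M) : ℝ :=
  (1 / 2) * (dirDeriv X (pairing g Y Z) x + dirDeriv Y (pairing g X Z) x
    - dirDeriv Z (pairing g X Y) x
    + g.inner x (mlieBracket I X Y x) (Z x)
    - g.inner x (mlieBracket I X Z x) (Y x)
    - g.inner x (mlieBracket I Y Z x) (X x))

theorem mdiffAt_pairing (g : RiemMetric I M) {X Y : Π x : M, TangentSpace I x} {x : M}
    (hX : MDiffAt (T% X) x) (hY : MDiffAt (T% Y) x) : MDiffAt (pairing g X Y) x := by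
  let _ : RiemannianBundle (TangentSpace I : M → Type _) := ⟨g.toRiemannianMetric⟩
  exact MDifferentiableAt.inner_bundle (E := (TangentSpace I : M → Type _)) (F := E)
    (IB := I) (b := id) hX hY

theorem dirDeriv_add (X : Π x : M, TangentSpace I x) {f f' : M → ℝ} {x : M}
    (hf : MDiffAt f x) (hf' : MDiffAt f' x) :
    dirDeriv X (f + f') x = dirDeriv X f x + dirDeriv X f' x := by
  simp [dirDeriv, mvfderiv_add hf hf']

theorem dirDeriv_mul (X : Π x : M, TangentSpace I x) {f f' : M → ℝ} {x : M}
    (hf : MDiffAt f x) (hf' : MDiffAt f' x) :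
    dirDeriv X (f * f') x = f x * dirDeriv X f' x + f' x * dirDeriv X f x := by
  simp [dirDeriv, mvfderiv_mul hf hf']

theorem pairing_add_left (g : RiemMetric I M) (X X' Y : Π x : M, TangentSpace I x) :
    pairing g (X + X') Y = pairing g X Y + pairing g X' Y := by
  ext x; simp [pairing]

theorem pairing_add_right (g : RiemMetric I M) (X Y Y' : Π x : M, TangentSpace I x) :
    pairing g X (Y + Y') = pairing g X Y + pairing g X Y' := by
  ext x; simp [pairing]

theorem pairing_smul_left (g : RiemMetric I M) (f : M → ℝ) (X Y : Π x : M, TangentSpace I x) :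
    pairing g (f • X) Y = f * pairing g X Y := by
  ext x; simp [pairing]

theorem pairing_smul_right (g : RiemMetric I M) (f : M → ℝ) (X Y : Π x : M, TangentSpace I x) :
    pairing g X (f • Y) = f * pairing g X Y := by
  ext x; simp [pairing]

theorem dirDeriv_add_left (X X' : Π x : M, TangentSpace I x) (f : M → ℝ) (x : M) :
    dirDeriv (X + X') f x = dirDeriv X f x + dirDeriv X' f x := by
  simp [dirDeriv]

theorem dirDeriv_smul_left (h : M → ℝ) (X : Π x : M, TangentSpace I x) (f : M → ℝ) (x : M) :
    dirDeriv (h • X) f x = h x * dirDeriv X f x := by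
  simp [dirDeriv]

theorem koszul_tensorial_left (g : RiemMetric I M) {Y Z : Π x : M, TangentSpace I x} {x : M}
    (hY : MDiffAt (T% Y) x) (hZ : MDiffAt (T% Z) x) :
    TensorialAt I E (fun X ↦ koszul g Y X Z x) x where
  smul {f X} hf hX := by
    simp only [koszul, pairing_smul_left, dirDeriv_smul_left,
      dirDeriv_mul _ hf (mdiffAt_pairing g hX hZ), dirDeriv_mul _ hf (mdiffAt_pairing g hX hY),
      mlieBracket_smul_left hf hX]
    simp [dirDeriv, pairing]
    rw [g.symm x (X x) (Z x), g.symm x (X x) (Y x), g.symm x (mlieBracket I Y Z x) (X x)]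
    ring
  add {X X'} hX hX' := by
    simp only [koszul, pairing_add_left, dirDeriv_add_left,
      dirDeriv_add _ (mdiffAt_pairing g hX hZ) (mdiffAt_pairing g hX' hZ),
      dirDeriv_add _ (mdiffAt_pairing g hX hY) (mdiffAt_pairing g hX' hY),
      mlieBracket_add_left hX hX']
    simp
    ring

theorem koszul_tensorial_right (g : RiemMetric I M) {Y X : Π x : M, TangentSpace I x} {x : M}
    (hY : MDiffAt (T% Y) x) (hX : MDiffAt (T% X) x) :
    TensorialAt I E (fun Z ↦ koszul g Y X Z x) x where
  smul {f Z} hf hZ := by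
    simp only [koszul, pairing_smul_right, dirDeriv_smul_left,
      dirDeriv_mul _ hf (mdiffAt_pairing g hY hZ), dirDeriv_mul _ hf (mdiffAt_pairing g hX hZ),
      mlieBracket_smul_right hf hZ]
    simp [dirDeriv, pairing]
    rw [g.symm x (Z x) (Y x), g.symm x (Z x) (X x)]
    ring
  add {Z Z'} hZ hZ' := by
    simp only [koszul, pairing_add_right, dirDeriv_add_left,
      dirDeriv_add _ (mdiffAt_pairing g hY hZ) (mdiffAt_pairing g hY hZ'),
      dirDeriv_add _ (mdiffAt_pairing g hX hZ) (mdiffAt_pairing g hX hZ'),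
      mlieBracket_add_right hZ hZ']
    simp
    ring

theorem koszul_smul (g : RiemMetric I M) {f : M → ℝ} {Y X Z : Π x : M, TangentSpace I x} {x : M}
    (hf : MDiffAt f x)
    (hY : MDiffAt (T% Y) x) (hX : MDiffAt (T% X) x) (hZ : MDiffAt (T% Z) x) :
    koszul g (f • Y) X Z x
      = f x * koszul g Y X Z x + dirDeriv X f x * g.inner x (Y x) (Z x) := by
  simp only [koszul, pairing_smul_left, pairing_smul_right, dirDeriv_smul_left,
    dirDeriv_mul _ hf (mdiffAt_pairing g hY hZ), dirDeriv_mul _ hf (mdiffAt_pairing g hX hY),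
    mlieBracket_smul_left hf hY, mlieBracket_smul_right hf hY]
  simp [dirDeriv, pairing]
  rw [g.symm x (X x) (Y x)]
  ring

theorem koszul_add (g : RiemMetric I M) {Y Y' X Z : Π x : M, TangentSpace I x} {x : M}
    (hY : MDiffAt (T% Y) x) (hY' : MDiffAt (T% Y') x)
    (hX : MDiffAt (T% X) x) (hZ : MDiffAt (T% Z) x) :
    koszul g (Y + Y') X Z x = koszul g Y X Z x + koszul g Y' X Z x := by
  simp only [koszul, pairing_add_left, pairing_add_right, dirDeriv_add_left,
    dirDeriv_add _ (mdiffAt_pairing g hY hZ) (mdiffAt_pairing g hY' hZ),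
    dirDeriv_add _ (mdiffAt_pairing g hX hY) (mdiffAt_pairing g hX hY'),
    mlieBracket_add_left hY hY', mlieBracket_add_right hY hY']
  simp
  ring

instance (x : M) : FiniteDimensional ℝ (TangentSpace I x) :=
  inferInstanceAs (FiniteDimensional ℝ E)

instance (x : M) : T2Space (TangentSpace I x) :=
  inferInstanceAs (T2Space E)

/-- The metric at a point as a bilinear form. -/
def metricForm (g : RiemMetric I M) (x : M) : LinearMap.BilinForm ℝ (TangentSpace I x) :=
  LinearMap.mk₂ ℝ (fun u v ↦ g.inner x u v) (by simp) (by simp) (by simp) (by simp)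

theorem metricForm_nondegenerate (g : RiemMetric I M) (x : M) : (metricForm g x).Nondegenerate := by
  constructor
  · intro u hu
    by_contra h
    exact (g.pos x u h).ne' (hu u)
  · intro u hu
    by_contra h
    exact (g.pos x u h).ne' (hu u)

/-- Koszul's form `(u, w) ↦ g(∇_u Y, w)` at a point where `Y` is differentiable. -/
def koszulHom (g : RiemMetric I M) {Y : Π x : M, TangentSpace I x} {x : M} (hY : MDiffAt (T% Y) x) :
    TangentSpace I x →L[ℝ] TangentSpace I x →L[ℝ] ℝ :=
  TensorialAt.mkHom₂ (fun X Z ↦ koszul g Y X Z x) x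
    (fun _ hZ ↦ koszul_tensorial_left g hY hZ) (fun _ hX ↦ koszul_tensorial_right g hY hX)

open Classical in
/-- The vector `∇_u Y`, characterized by `g(∇_u Y, w) = koszulHom g hY u w`
(with the value `0` if `Y` is not differentiable at the point). -/
def leviCivitaFun (g : RiemMetric I M) (Y : Π x : M, TangentSpace I x) (x : M) :
    TangentSpace I x →L[ℝ] TangentSpace I x :=
  if hY : MDiffAt (T% Y) x then
    LinearMap.toContinuousLinearMap
      (((metricForm g x).toDual (metricForm_nondegenerate g x)).symm.toLinearMap ∘ₗ
        (ContinuousLinearMap.coeLM ℝ ∘ₗ (koszulHom g hY).toLinearMap))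
  else 0

theorem inner_leviCivitaFun (g : RiemMetric I M) {X Y Z : Π x : M, TangentSpace I x} {x : M}
    (hX : MDiffAt (T% X) x) (hY : MDiffAt (T% Y) x) (hZ : MDiffAt (T% Z) x) :
    g.inner x (leviCivitaFun g Y x (X x)) (Z x) = koszul g Y X Z x := by
  have h := LinearMap.BilinForm.apply_toDual_symm_apply (hB := metricForm_nondegenerate g x)
    (f := ((koszulHom g hY (X x) : TangentSpace I x →L[ℝ] ℝ) : TangentSpace I x →ₗ[ℝ] ℝ)) (Z x)
  have h2 : koszulHom g hY (X x) (Z x) = koszul g Y X Z x :=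
    TensorialAt.mkHom₂_apply (Φ := fun X Z ↦ koszul g Y X Z x) _ _ hX hZ
  rw [leviCivitaFun, dif_pos hY, ← h2]
  exact h

theorem inner_ext (g : RiemMetric I M) {x : M} {u v : TangentSpace I x}
    (h : ∀ w, g.inner x u w = g.inner x v w) : u = v := by
  by_contra hne
  have := g.pos x (u - v) (sub_ne_zero.2 hne)
  simp [h] at this

/-- The Levi-Civita connection of a Riemannian metric; `leviCivita g Y x u` is `∇_u Y`. -/
def leviCivita (g : RiemMetric I M) : CovariantDerivative I E (TangentSpace I : M → Type _) where
  toFun := leviCivitaFun g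
  isCovariantDerivativeOnUniv :=
    { add := by
        intro Y Y' x hY hY' _
        ext u
        refine inner_ext g fun w ↦ ?_
        have hu := mdifferentiableAt_extend I E u
        have hw := mdifferentiableAt_extend I E w
        have h1 := inner_leviCivitaFun g hu (mdifferentiableAt_add_section hY hY') hw
        have h2 := inner_leviCivitaFun g hu hY hw
        have h3 := inner_leviCivitaFun g hu hY' hw
        have h4 := koszul_add g hY hY' hu hw
        simp only [extend_apply_self] at h1 h2 h3
        simp [h2, h3, ← h4, ← h1]
      leibniz := by
        intro Y f x hY hf _
        ext u
        refine inner_ext g fun w ↦ ?_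
        have hu := mdifferentiableAt_extend I E u
        have hw := mdifferentiableAt_extend I E w
        have h1 := inner_leviCivitaFun g hu (hf.smul_section hY) hw
        have h2 := inner_leviCivitaFun g hu hY hw
        have h4 := koszul_smul g hf hY hu hw
        simp only [extend_apply_self, dirDeriv] at h1 h2 h4
        simp [h2]
        rw [← h4]
        exact h1 }

theorem inner_leviCivita (g : RiemMetric I M) {X Y Z : Π x : M, TangentSpace I x} {x : M}
    (hX : MDiffAt (T% X) x) (hY : MDiffAt (T% Y) x) (hZ : MDiffAt (T% Z) x) :
    g.inner x (leviCivita g Y x (X x)) (Z x) = koszul g Y X Z x :=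
  inner_leviCivitaFun g hX hY hZ

theorem leviCivita_torsion_free (g : RiemMetric I M) {X Y : Π x : M, TangentSpace I x} {x : M}
    (hX : MDiffAt (T% X) x) (hY : MDiffAt (T% Y) x) :
    leviCivita g Y x (X x) - leviCivita g X x (Y x) = mlieBracket I X Y x := by
  refine inner_ext g fun w ↦ ?_
  have hw := mdifferentiableAt_extend I E w
  have h1 := inner_leviCivita g hX hY hw
  have h2 := inner_leviCivita g hY hX hw
  simp only [extend_apply_self] at h1 h2
  have hs : pairing g Y X = pairing g X Y := by ext y; exact g.symm y _ _
  simp [h1, h2, koszul, hs, mlieBracket_swap_apply (V := Y) (W := X)]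
  ring

theorem leviCivita_metric (g : RiemMetric I M) {X Y Z : Π x : M, TangentSpace I x} {x : M}
    (hX : MDiffAt (T% X) x) (hY : MDiffAt (T% Y) x) (hZ : MDiffAt (T% Z) x) :
    dirDeriv X (pairing g Y Z) x
      = g.inner x (leviCivita g Y x (X x)) (Z x) + g.inner x (Y x) (leviCivita g Z x (X x)) := by
  have hs : pairing g Z Y = pairing g Y Z := by ext y; exact g.symm y _ _
  rw [g.symm x (Y x), inner_leviCivita g hX hY hZ, inner_leviCivita g hX hZ hY]
  simp [koszul, hs, mlieBracket_swap_apply (V := Z) (W := Y)]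
  ring

/-! ### Curvature, divergence, Lie derivative of the metric -/

/-- `R(X,Y)Z = ∇_X ∇_Y Z - ∇_Y ∇_X Z - ∇_{[X,Y]} Z`. -/
def curvature (g : RiemMetric I M) (X Y Z : Π x : M, TangentSpace I x) (x : M) : TangentSpace I x :=
  leviCivita g (fun y ↦ leviCivita g Z y (Y y)) x (X x)
    - leviCivita g (fun y ↦ leviCivita g Z y (X y)) x (Y x)
    - leviCivita g Z x (mlieBracket I X Y x)

/-- The Ricci tensor: `Ric(u,v)` is the trace of `w ↦ R(w,u)v`, computed in a basis of the tangent
space. Tangent vectors are extended to vector fields that are smooth near the point; the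
curvature does not depend on the extensions. -/
def ricci (g : RiemMetric I M) (x : M) (u v : TangentSpace I x) : ℝ :=
  ∑ i, (Module.finBasis ℝ (TangentSpace I x)).coord i
    (curvature g (extend E (Module.finBasis ℝ (TangentSpace I x) i)) (extend E u) (extend E v) x)

/-- An orthonormal basis of the tangent space at a point. -/
def onb (g : RiemMetric I M) (x : M) :
    Fin (Module.finrank ℝ (TangentSpace I x)) → TangentSpace I x :=
  letI : RiemannianBundle (TangentSpace I : M → Type _) := ⟨g.toRiemannianMetric⟩
  stdOrthonormalBasis ℝ (TangentSpace I x)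

theorem inner_onb (g : RiemMetric I M) (x : M) (i j : Fin (Module.finrank ℝ (TangentSpace I x))) :
    g.inner x (onb g x i) (onb g x j) = if i = j then 1 else 0 := by
  let _ : RiemannianBundle (TangentSpace I : M → Type _) := ⟨g.toRiemannianMetric⟩
  exact orthonormal_iff_ite.1 (stdOrthonormalBasis ℝ (TangentSpace I x)).orthonormal i j

/-- The scalar curvature, i.e. the trace of the Ricci tensor with respect to the metric. -/
def scal (g : RiemMetric I M) (x : M) : ℝ := ∑ i, ricci g x (onb g x i) (onb g x i)

/-- The divergence of a vector field: the trace of `u ↦ ∇_u V`. -/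
def divergence (g : RiemMetric I M) (V : Π x : M, TangentSpace I x) (x : M) : ℝ :=
  LinearMap.trace ℝ (TangentSpace I x) (leviCivita g V x)

/-- `(£_V g)(X,Y) = V(g(X,Y)) - g([V,X],Y) - g(X,[V,Y])`. -/
def lieDerivMetric (g : RiemMetric I M) (V X Y : Π x : M, TangentSpace I x) (x : M) : ℝ :=
  dirDeriv V (pairing g X Y) x
    - g.inner x (mlieBracket I V X x) (Y x) - g.inner x (X x) (mlieBracket I V Y x)

/-- `(V, lam)` is an almost Ricci soliton for `g`: `V` is a smooth vector field, `lam` a smooth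
function, and `½ £_V g + Ric = lam g`. -/
structure IsAlmostRicciSoliton (g : RiemMetric I M) (V : Π x : M, TangentSpace I x) (lam : M → ℝ) :
    Prop where
  smooth_field : CMDiff ∞ (T% V)
  smooth_fun : CMDiff ∞ lam
  equation : ∀ (x : M) (X Y : Π x : M, TangentSpace I x),
    CMDiffAt ∞ (T% X) x → CMDiffAt ∞ (T% Y) x →
      (1 / 2) * lieDerivMetric g V X Y x + ricci g x (X x) (Y x) = lam x * g.inner x (X x) (Y x)

/-! ### Almost contact metric structures -/

variable (I M) in
/-- An almost contact metric structure `(φ, ξ, η, g)`. -/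
structure AlmostContactMetric where
  /-- The Riemannian metric. -/
  g : RiemMetric I M
  /-- The (1,1)-tensor field. -/
  φ : Π x : M, TangentSpace I x →L[ℝ] TangentSpace I x
  /-- The Reeb vector field. -/
  ξ : Π x : M, TangentSpace I x
  /-- The 1-form. -/
  η : Π x : M, TangentSpace I x →L[ℝ] ℝ
  smooth_φ : ContMDiff I (I.prod 𝓘(ℝ, E →L[ℝ] E)) ∞
    (fun x ↦ TotalSpace.mk' (E →L[ℝ] E) (E := fun x : M ↦ TangentSpace I x →L[ℝ] TangentSpace I x)
      x (φ x))
  smooth_ξ : CMDiff ∞ (T% ξ)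
  smooth_η : ContMDiff I (I.prod 𝓘(ℝ, E →L[ℝ] ℝ)) ∞
    (fun x ↦ TotalSpace.mk' (E →L[ℝ] ℝ) (E := fun x : M ↦ TangentSpace I x →L[ℝ] ℝ) x (η x))
  φ_sq : ∀ (x : M) (v : TangentSpace I x), φ x (φ x v) = -v + η x v • ξ x
  η_ξ : ∀ x : M, η x (ξ x) = 1
  η_eq : ∀ (x : M) (v : TangentSpace I x), η x v = g.inner x (ξ x) v
  compat : ∀ (x : M) (u v : TangentSpace I x),
    g.inner x (φ x u) (φ x v) = g.inner x u v - η x u * η x v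

/-- The Kenmotsu condition `(∇_u φ) Y = g(φ u, Y) ξ - η(Y) φ u`, where
`(∇_u φ) Y = ∇_u (φ Y) - φ (∇_u Y)`. -/
def AlmostContactMetric.IsKenmotsu (S : AlmostContactMetric I M) : Prop :=
  ∀ Y : Π x : M, TangentSpace I x, CMDiff ∞ (T% Y) → ∀ (x : M) (u : TangentSpace I x),
    leviCivita S.g (fun y ↦ S.φ y (Y y)) x u - S.φ x (leviCivita S.g Y x u)
      = S.g.inner x (S.φ x u) (Y x) • S.ξ x - S.η x (Y x) • S.φ x u

/-- The form `η ⊗ η`. -/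
def AlmostContactMetric.etaSq (S : AlmostContactMetric I M) (x : M) :
    TangentSpace I x →L[ℝ] TangentSpace I x →L[ℝ] ℝ :=
  (S.η x).smulRight (S.η x)

theorem AlmostContactMetric.η_φ (S : AlmostContactMetric I M) (x : M) (v : TangentSpace I x) :
    S.η x (S.φ x v) = 0 := by
  have h0 : S.φ x (S.ξ x) = 0 := by
    by_contra h
    have h1 := S.g.pos x _ h
    rw [S.compat, ← S.η_eq, S.η_ξ] at h1
    simp at h1
  have h1 := congrArg (S.φ x) (S.φ_sq x v)
  rw [S.φ_sq x (S.φ x v), map_add, map_neg, map_smul, h0] at h1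
  simpa [S.η_ξ] using congrArg (S.η x) h1

theorem AlmostContactMetric.η_sq_le (S : AlmostContactMetric I M) (x : M)
    (v : TangentSpace I x) : S.η x v * S.η x v ≤ S.g.inner x v v := by
  have h := S.compat x v v
  rcases eq_or_ne (S.φ x v) 0 with h0 | h0
  · simp [h0] at h; linarith
  · have := S.g.pos x _ h0; linarith

set_option synthInstance.maxHeartbeats 400000 in
theorem AlmostContactMetric.smooth_etaSq (S : AlmostContactMetric I M) :
    ContMDiff I (I.prod 𝓘(ℝ, E →L[ℝ] E →L[ℝ] ℝ)) ∞
      (fun x ↦ TotalSpace.mk' (E →L[ℝ] E →L[ℝ] ℝ)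
        (E := fun x : M ↦ TangentSpace I x →L[ℝ] TangentSpace I x →L[ℝ] ℝ) x (S.etaSq x)) := by
  intro x
  have h := S.smooth_η x
  rw [contMDiffAt_hom_bundle] at h ⊢
  refine ⟨contMDiffAt_id, ?_⟩
  have h2 := S.smooth_η x
  rw [contMDiffAt_section] at h2
  have h3 := contMDiffAt_smulRight h.2 h2
  refine h3.congr_of_eventuallyEq ?_
  have hmem := (trivializationAt (E →L[ℝ] ℝ)
    (fun x : M ↦ TangentSpace I x →L[ℝ] ℝ) x).open_baseSet.mem_nhds
      (mem_baseSet_trivializationAt (E →L[ℝ] ℝ) (fun x : M ↦ TangentSpace I x →L[ℝ] ℝ) x)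
  filter_upwards [hmem] with y hy
  ext v w
  simp [ContinuousLinearMap.inCoordinates, AlmostContactMetric.etaSq,
    Bundle.Trivialization.continuousLinearMapAt_apply, Trivialization.linearMapAt_apply]
  left
  exact congrArg (fun L : E →L[ℝ] ℝ ↦ L w) (if_pos hy)

set_option synthInstance.maxHeartbeats 400000 in
/-- The deformed metric `a g + a (a - 1) η ⊗ η`. -/
def AlmostContactMetric.deformMetric (S : AlmostContactMetric I M) (a : ℝ) (ha : 0 < a) :
    RiemMetric I M where
  inner x := a • S.g.inner x + (a * (a - 1)) • S.etaSq x
  symm x v w := by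
    simp [AlmostContactMetric.etaSq, S.g.symm x v w, mul_comm (S.η x v)]
  pos x v hv := by
    have h1 := S.η_sq_le x v
    have h2 := S.g.pos x v hv
    simp only [AlmostContactMetric.etaSq, add_apply,
      smul_apply, ContinuousLinearMap.smulRight_apply, smul_eq_mul]
    rcases (mul_self_nonneg (S.η x v)).eq_or_lt with h | h
    · rw [← h]; simp; positivity
    · nlinarith [mul_pos (mul_pos ha ha) h, mul_nonneg ha.le (sub_nonneg.2 h1)]
  isVonNBounded x := by
    set c : ℝ := min a (a * a) with hc
    have hc0 : 0 < c := lt_min ha (mul_pos ha ha)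
    have hs : 0 < Real.sqrt c := Real.sqrt_pos.2 hc0
    have hb := (S.g.isVonNBounded x).image
      ((Real.sqrt c)⁻¹ • ContinuousLinearMap.id ℝ (TangentSpace I x))
    refine hb.subset ?_
    intro v hv
    refine ⟨Real.sqrt c • v, ?_, ?_⟩
    · have h1 := S.η_sq_le x v
      have h2 := mul_self_nonneg (S.η x v)
      have h3 : c ≤ a := min_le_left _ _
      have h4 : c ≤ a * a := min_le_right _ _
      simp only [AlmostContactMetric.etaSq, add_apply, Set.mem_ofPred_eq,
        smul_apply, ContinuousLinearMap.smulRight_apply, smul_eq_mul] at hv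
      simp only [Set.mem_ofPred_eq, map_smul, smul_apply, smul_eq_mul]
      rw [← mul_assoc, Real.mul_self_sqrt hc0.le]
      nlinarith [mul_le_mul_of_nonneg_right h3 (sub_nonneg.2 h1),
        mul_le_mul_of_nonneg_right h4 h2]
    · simp [smul_smul, hs.ne']
  contMDiff := by
    have h1 := S.g.contMDiff.const_smul_section (a := a)
    have h2 := S.smooth_etaSq.const_smul_section (a := a * (a - 1))
    exact h1.add_section h2

/-- The `D`-homothetic deformation
`(φ, a⁻¹ ξ, a η, a g + a (a - 1) η ⊗ η)` of an almost contact metric structure. -/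
def AlmostContactMetric.deform (S : AlmostContactMetric I M) (a : ℝ) (ha : 0 < a) :
    AlmostContactMetric I M where
  g := S.deformMetric a ha
  φ := S.φ
  ξ := fun x ↦ (1 / a) • S.ξ x
  η := fun x ↦ a • S.η x
  smooth_φ := S.smooth_φ
  smooth_ξ := S.smooth_ξ.const_smul_section (a := 1 / a)
  smooth_η := S.smooth_η.const_smul_section (a := a)
  φ_sq x v := by
    rw [S.φ_sq]
    simp [smul_smul]
    field_simp
  η_ξ x := by
    simp [S.η_ξ]
    field_simp
  η_eq x v := by
    simp [AlmostContactMetric.deformMetric, AlmostContactMetric.etaSq, S.η_ξ, ← S.η_eq]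
    field_simp
    ring
  compat x u v := by
    simp [AlmostContactMetric.deformMetric, AlmostContactMetric.etaSq, S.η_φ, S.compat]
    ring

end AlmostContact

end

open AlmostContact

/-!
The Kenmotsu condition enters only through `∇_u ξ = u - η(u) ξ`. With the transverse metric
`h = g - η ⊗ η` one has `ḡ = a h + a² η ⊗ η`, and the connection `∇ + (1 - 1/a) h ⊗ ξ` is
torsion-free and preserves `ḡ`, so it is the Levi-Civita connection of `ḡ`. Because `h`
annihilates `ξ`, the quadratic terms in its curvature drop out: `R(X,Y)Z` changes by
`(1 - 1/a) (h(Y,Z) X - h(X,Z) Y)` and the Ricci tensor by `(dim M - 1) (1 - 1/a) h`. On the other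
hand `R(X,Y)ξ = η(X) Y - η(Y) X`, so `Ric(ξ,ξ) = -(dim M - 1)`. The soliton equation evaluated on
`(ξ,ξ)` therefore determines the soliton function; substituting it back gives the Ricci tensor,
and a trace gives the scalar curvature.
-/

namespace AlmostContact

open Bundle VectorField FiberBundle
open scoped Topology

variable {E : Type*} [NormedAddCommGroup E] [NormedSpace ℝ E]
  {H : Type*} [TopologicalSpace H] {I : ModelWithCorners ℝ E H}
  {M : Type*} [TopologicalSpace M] [ChartedSpace H M]

section Smoothness

variable {E' H' M' : Type*} [NormedAddCommGroup E'] [NormedSpace ℝ E'] [TopologicalSpace H']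
  {I' : ModelWithCorners ℝ E' H'} [TopologicalSpace M'] [ChartedSpace H' M']

theorem mdifferentiableAt_of_smoothAt {f : M → M'} {x : M} (hf : ContMDiffAt I I' ∞ f x) :
    MDifferentiableAt I I' f x :=
  hf.mdifferentiableAt (by simp)

variable [IsManifold I ∞ M]

theorem eventually_mdifferentiableAt_of_smoothAt [IsManifold I' ∞ M'] {f : M → M'} {x : M}
    (hf : ContMDiffAt I I' ∞ f x) : ∀ᶠ y in 𝓝 x, MDifferentiableAt I I' f y := by
  have hf₁ : ContMDiffAt I I' 1 f x := hf.of_le (mod_cast le_top)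
  exact ((contMDiffAt_iff_contMDiffAt_nhds (by simp)).1 hf₁).mono fun y hy ↦
    hy.mdifferentiableAt one_ne_zero

theorem contMDiffAt_pairing (g : RiemMetric I M) {X Y : Π x : M, TangentSpace I x} {x : M}
    (hX : CMDiffAt ∞ (T% X) x) (hY : CMDiffAt ∞ (T% Y) x) : CMDiffAt ∞ (pairing g X Y) x := by
  let _ : RiemannianBundle (TangentSpace I : M → Type _) := ⟨g.toRiemannianMetric⟩
  exact ContMDiffAt.inner_bundle (E := (TangentSpace I : M → Type _)) (F := E)
    (IB := I) (b := id) hX hY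

theorem contMDiffAt_dirDeriv {X : Π x : M, TangentSpace I x} {f : M → ℝ} {x : M}
    (hX : CMDiffAt ∞ (T% X) x) (hf : CMDiffAt ∞ f x) : CMDiffAt ∞ (dirDeriv X f) x := by
  have hdf := ContMDiffAt.mfderiv_const (m := ∞) hf (by simp)
  have hXf := ContMDiffAt.clm_apply_of_inCoordinates (b₁ := id) (b₂ := f) hdf hX hf
  exact (contMDiff_snd_tangentBundle_modelSpace ℝ 𝓘(ℝ, ℝ)).contMDiffAt.comp x hXf

theorem natCast_minSmoothness_le_infty (k : ℕ) : minSmoothness ℝ k ≤ ∞ := by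
  rw [minSmoothness_of_isRCLikeNormedField]
  exact WithTop.coe_le_coe.2 (le_top : (k : ℕ∞) ≤ ⊤)

variable [CompleteSpace E]

theorem contMDiffAt_mlieBracket {X Y : Π x : M, TangentSpace I x} {x : M}
    (hX : CMDiffAt ∞ (T% X) x) (hY : CMDiffAt ∞ (T% Y) x) :
    CMDiffAt ∞ (T% (mlieBracket I X Y)) x :=
  have : IsManifold I (minSmoothness ℝ 2) M := .of_le (natCast_minSmoothness_le_infty 2)
  have : IsManifold I ((⊤ : ℕ∞) + 1) M := inferInstanceAs (IsManifold I ∞ M)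
  ContMDiffAt.mlieBracket_vectorField (n := ⊤) (m := ⊤) hX hY (by simp)

theorem contMDiffAt_koszul (g : RiemMetric I M) {X Y Z : Π x : M, TangentSpace I x} {x : M}
    (hY : CMDiffAt ∞ (T% Y) x) (hX : CMDiffAt ∞ (T% X) x) (hZ : CMDiffAt ∞ (T% Z) x) :
    CMDiffAt ∞ (koszul g Y X Z) x := by
  have hXYZ := contMDiffAt_dirDeriv hX (contMDiffAt_pairing g hY hZ)
  have hYXZ := contMDiffAt_dirDeriv hY (contMDiffAt_pairing g hX hZ)
  have hZXY := contMDiffAt_dirDeriv hZ (contMDiffAt_pairing g hX hY)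
  have hXY := contMDiffAt_pairing g (contMDiffAt_mlieBracket hX hY) hZ
  have hXZ := contMDiffAt_pairing g (contMDiffAt_mlieBracket hX hZ) hY
  have hYZ := contMDiffAt_pairing g (contMDiffAt_mlieBracket hY hZ) hX
  exact contMDiffAt_const.mul (((((hXYZ.add hYXZ).sub hZXY).add hXY).sub hXZ).sub hYZ)

end Smoothness

section GramMap

variable [IsManifold I ∞ M] {ι : Type*} [Fintype ι] [DecidableEq ι]

/-- The Gram map of a family `s` of vector fields at the point `y`: it sends the coefficients `c`
to the inner products of `∑ i, c i • s i y` with the `s j y`. -/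
noncomputable def gramMap (g : RiemMetric I M) (s : ι → Π x : M, TangentSpace I x) (y : M) :
    (ι → ℝ) →L[ℝ] (ι → ℝ) :=
  ∑ i, ∑ j, pairing g (s i) (s j) y •
    (ContinuousLinearMap.proj (R := ℝ) (φ := fun _ : ι ↦ ℝ) i).smulRight (Pi.single j (1 : ℝ))

theorem gramMap_apply (g : RiemMetric I M) (s : ι → Π x : M, TangentSpace I x) (y : M)
    (c : ι → ℝ) (j : ι) : gramMap g s y c j = g.inner y (∑ i, c i • s i y) (s j y) := by
  simp [gramMap, pairing, Finset.sum_apply, Pi.single_apply, mul_comm]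

theorem contMDiffAt_gramMap (g : RiemMetric I M) {s : ι → Π x : M, TangentSpace I x} {x : M}
    (hs : ∀ i, CMDiffAt ∞ (T% (s i)) x) : CMDiffAt ∞ (gramMap g s) x := by
  refine contMDiffAt_finsetSum fun i _ ↦ contMDiffAt_finsetSum fun j _ ↦ ?_
  exact (contMDiffAt_pairing g (hs i) (hs j)).smul contMDiffAt_const

theorem gramMap_isInvertible (g : RiemMetric I M) {s : ι → Π x : M, TangentSpace I x} {y : M}
    (hs : LinearIndependent ℝ (s · y)) : (gramMap g s y).IsInvertible := by
  have hinj : Function.Injective (gramMap g s y).toLinearMap := by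
    rw [injective_iff_map_eq_zero]
    intro c hc
    have hsum : ∑ i, c i • s i y = 0 := by
      by_contra hne
      have hzero : g.inner y (∑ i, c i • s i y) (∑ j, c j • s j y) = 0 := by
        rw [map_sum]
        refine Finset.sum_eq_zero fun j _ ↦ ?_
        rw [map_smul, ← gramMap_apply, show gramMap g s y c = 0 from hc, Pi.zero_apply, smul_zero]
      exact (g.pos y _ hne).ne' hzero
    exact funext (Fintype.linearIndependent_iff.1 hs c hsum)
  exact ⟨(LinearEquiv.ofInjectiveEndo _ hinj).toContinuousLinearEquiv, by ext; rfl⟩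

variable [FiniteDimensional ℝ E]

theorem contMDiffAt_of_contMDiffAt_pairing (g : RiemMetric I M) {W : Π x : M, TangentSpace I x}
    {x : M} (h : ∀ Z : Π x : M, TangentSpace I x, CMDiffAt ∞ (T% Z) x →
      CMDiffAt ∞ (pairing g W Z) x) : CMDiffAt ∞ (T% W) x := by
  let t := trivializationAt E (TangentSpace I : M → Type _) x
  have hx : x ∈ t.baseSet := FiberBundle.mem_baseSet_trivializationAt E (TangentSpace I) x
  let b := Module.finBasis ℝ E
  let s := t.localFrame b
  have hs (i) : CMDiffAt ∞ (T% (s i)) x := contMDiffAt_localFrame_of_mem ∞ _ b i hx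
  have hinv (y : M) (hy : y ∈ t.baseSet) : (gramMap g s y).IsInvertible :=
    gramMap_isInvertible g ((t.isLocalFrameOn_localFrame_baseSet I ∞ b).linearIndependent hy)
  have hGinv : CMDiffAt ∞ (fun y ↦ (gramMap g s y).inverse) x :=
    (hinv x hx).contDiffAt_map_inverse.contMDiffAt.comp x (contMDiffAt_gramMap g hs)
  have hpair : ContMDiffAt I 𝓘(ℝ, Fin (Module.finrank ℝ E) → ℝ) ∞
      (fun y j ↦ pairing g W (s j) y) x :=
    contMDiffAt_pi_space.2 fun j ↦ h _ (hs j)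
  rw [contMDiffAt_iff_localFrameCoeff (e := t) b hx]
  intro i
  refine (contMDiffAt_pi_space.1 (hGinv.clm_apply hpair) i).congr_of_eventuallyEq ?_
  filter_upwards [t.open_baseSet.mem_nhds hx] with y hy
  have hW : (fun j ↦ pairing g W (s j) y)
      = gramMap g s y (fun i ↦ t.localFrameCoeff I b i y (W y)) := by
    ext j
    rw [gramMap_apply, pairing, ← t.eq_sum_localFrameCoeff_smul hy]
  rw [hW, (hinv y hy).inverse_apply_self]
  rfl

theorem contMDiffAt_leviCivita (g : RiemMetric I M) {X Y : Π x : M, TangentSpace I x} {x : M}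
    (hX : CMDiffAt ∞ (T% X) x) (hY : CMDiffAt ∞ (T% Y) x) :
    CMDiffAt ∞ (T% (fun y ↦ leviCivita g Y y (X y))) x := by
  have : CompleteSpace E := FiniteDimensional.complete ℝ E
  refine contMDiffAt_of_contMDiffAt_pairing g fun Z hZ ↦
    (contMDiffAt_koszul g hY hX hZ).congr_of_eventuallyEq ?_
  filter_upwards [eventually_mdifferentiableAt_of_smoothAt hX,
    eventually_mdifferentiableAt_of_smoothAt hY, eventually_mdifferentiableAt_of_smoothAt hZ]
    with y hXy hYy hZy
  exact inner_leviCivita g hXy hYy hZy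

end GramMap

section LieBracket

variable [CompleteSpace E] [IsManifold I ∞ M]

theorem mlieBracket_mlieBracket_smul {X Y Z : Π x : M, TangentSpace I x} {f : M → ℝ} {x : M}
    (hY : CMDiffAt ∞ (T% Y) x) (hZ : CMDiffAt ∞ (T% Z) x) (hf : CMDiffAt ∞ f x) :
    mlieBracket I X (mlieBracket I Y (f • Z)) x
      = dirDeriv X (dirDeriv Y f) x • Z x + dirDeriv Y f x • mlieBracket I X Z x
        + dirDeriv X f x • mlieBracket I Y Z x + f x • mlieBracket I X (mlieBracket I Y Z) x := by
  have hinner : mlieBracket I Y (f • Z) =ᶠ[𝓝 x] dirDeriv Y f • Z + f • mlieBracket I Y Z := by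
    filter_upwards [eventually_mdifferentiableAt_of_smoothAt hf,
      eventually_mdifferentiableAt_of_smoothAt hZ] with y hfy hZy
    rw [mlieBracket_smul_right hfy hZy]
    rfl
  have hfx := mdifferentiableAt_of_smoothAt hf
  have hZx := mdifferentiableAt_of_smoothAt hZ
  have hYf := mdifferentiableAt_of_smoothAt (contMDiffAt_dirDeriv hY hf)
  have hYZ := mdifferentiableAt_of_smoothAt (contMDiffAt_mlieBracket hY hZ)
  rw [(Filter.EventuallyEq.refl (𝓝 x) X).mlieBracket_vectorField_eq hinner,
    mlieBracket_add_right (hYf.smul_section hZx) (hfx.smul_section hYZ),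
    mlieBracket_smul_right hYf hZx, mlieBracket_smul_right hfx hYZ]
  simp only [dirDeriv]
  abel

theorem dirDeriv_mlieBracket {X Y : Π x : M, TangentSpace I x} {f : M → ℝ} {x : M}
    (hX : CMDiffAt ∞ (T% X) x) (hY : CMDiffAt ∞ (T% Y) x) (hf : CMDiffAt ∞ f x) :
    dirDeriv (mlieBracket I X Y) f x
      = dirDeriv X (dirDeriv Y f) x - dirDeriv Y (dirDeriv X f) x := by
  rcases subsingleton_or_nontrivial (TangentSpace I x) with _ | _
  · simp [dirDeriv, Subsingleton.elim (X x) 0, Subsingleton.elim (Y x) 0,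
      Subsingleton.elim (mlieBracket I X Y x) 0]
  obtain ⟨v, hv⟩ := exists_ne (0 : TangentSpace I x)
  let Z : Π x : M, TangentSpace I x := extend E v
  have hZ : CMDiffAt ∞ (T% Z) x := contMDiffAt_extend I E v
  have hle := natCast_minSmoothness_le_infty 2
  have : IsManifold I (minSmoothness ℝ 3) M := .of_le (natCast_minSmoothness_le_infty 3)
  have hfx := mdifferentiableAt_of_smoothAt hf
  have hjacobi := leibniz_identity_mlieBracket_apply (hX.of_le hle) (hY.of_le hle) (hZ.of_le hle)
  have hjacobi_smul := leibniz_identity_mlieBracket_apply (hX.of_le hle) (hY.of_le hle)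
    ((hf.smul_section hZ).of_le hle)
  rw [mlieBracket_mlieBracket_smul hY hZ hf, mlieBracket_mlieBracket_smul hX hZ hf,
    mlieBracket_smul_right hfx (mdifferentiableAt_of_smoothAt hZ), hjacobi] at hjacobi_smul
  have hcomm : (dirDeriv (mlieBracket I X Y) f x
      - (dirDeriv X (dirDeriv Y f) x - dirDeriv Y (dirDeriv X f) x)) • Z x = 0 := by
    simp only [dirDeriv] at hjacobi_smul ⊢
    linear_combination (norm := module) (-1 : ℝ) • hjacobi_smul
  have hZx : Z x ≠ 0 := (extend_apply_self E v).trans_ne hv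
  exact sub_eq_zero.1 ((smul_eq_zero.1 hcomm).resolve_right hZx)

end LieBracket

section Tensoriality

variable [IsManifold I ∞ M] {F : Type*} [AddCommGroup F] [Module ℝ F]

/-- `Φ` is additive and homogeneous over functions on the vector fields that are smooth at `x`.
Mathlib's `TensorialAt` asks for this on all fields differentiable at `x`, which is too much
for operators of second order such as the curvature. -/
structure SmoothTensorialAt (Φ : (Π x : M, TangentSpace I x) → F) (x : M) : Prop where
  add : ∀ {Z Z' : Π x : M, TangentSpace I x}, CMDiffAt ∞ (T% Z) x → CMDiffAt ∞ (T% Z') x →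
    Φ (Z + Z') = Φ Z + Φ Z'
  smul : ∀ {f : M → ℝ} {Z : Π x : M, TangentSpace I x}, CMDiffAt ∞ f x → CMDiffAt ∞ (T% Z) x →
    Φ (f • Z) = f x • Φ Z

namespace SmoothTensorialAt

variable {Φ : (Π x : M, TangentSpace I x) → F} {x : M}

theorem congr (hΦ : SmoothTensorialAt Φ x) {Z Z' : Π x : M, TangentSpace I x}
    (hZ : CMDiffAt ∞ (T% Z) x) (hZ' : CMDiffAt ∞ (T% Z') x) (h : Z =ᶠ[𝓝 x] Z') : Φ Z = Φ Z' := by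
  classical
  -- The indicator function of the set where the two fields agree is smooth at `x`.
  let χ : M → ℝ := fun y ↦ if Z y = Z' y then 1 else 0
  have hχ : CMDiffAt ∞ χ x := (contMDiffAt_const (c := (1 : ℝ))).congr_of_eventuallyEq
    (h.mono fun y hy ↦ if_pos hy)
  have hχx : χ x = 1 := if_pos h.self_of_nhds
  have hmul : χ • Z = χ • Z' := by
    ext1 y
    by_cases hy : Z y = Z' y <;> simp [χ, hy]
  simpa [hΦ.smul hχ hZ, hΦ.smul hχ hZ', hχx] using congrArg Φ hmul

theorem sum (hΦ : SmoothTensorialAt Φ x) {ι : Type*} (s : Finset ι)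
    {Z : ι → Π x : M, TangentSpace I x} (hZ : ∀ i, CMDiffAt ∞ (T% (Z i)) x) :
    Φ (fun y ↦ ∑ i ∈ s, Z i y) = ∑ i ∈ s, Φ (Z i) := by
  classical
  induction s using Finset.induction_on with
  | empty =>
    have hzero : CMDiffAt ∞ (T% (0 : Π x : M, TangentSpace I x)) x :=
      contMDiff_zeroSection ℝ (TangentSpace I) x
    have hadd := hΦ.add hzero hzero
    rwa [add_zero, left_eq_add] at hadd
  | insert i s hi ih =>
    simp only [Finset.sum_insert hi, ← ih]
    exact hΦ.add (hZ i) (.sum_section fun j _ ↦ hZ j)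

theorem eq_of_eq [FiniteDimensional ℝ E] (hΦ : SmoothTensorialAt Φ x)
    {Z Z' : Π x : M, TangentSpace I x} (hZ : CMDiffAt ∞ (T% Z) x) (hZ' : CMDiffAt ∞ (T% Z') x)
    (h : Z x = Z' x) : Φ Z = Φ Z' := by
  let t := trivializationAt E (TangentSpace I : M → Type _) x
  have hx : x ∈ t.baseSet := FiberBundle.mem_baseSet_trivializationAt E (TangentSpace I) x
  let b := Module.finBasis ℝ E
  let s := t.localFrame b
  have hs (i) : CMDiffAt ∞ (T% (s i)) x := contMDiffAt_localFrame_of_mem ∞ _ b i hx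
  have expand {Z : Π x : M, TangentSpace I x} (hZ : CMDiffAt ∞ (T% Z) x) :
      Φ Z = ∑ i, t.localFrameCoeff I b i x (Z x) • Φ (s i) := by
    have hc (i) := contMDiffAt_localFrameCoeff (e := t) b hx hZ i
    have hcs (i) := (hc i).smul_section (hs i)
    rw [hΦ.congr hZ (.sum_section fun i _ ↦ hcs i)
      (t.eventually_eq_localFrame_sum_coeff_smul b hx)]
    exact (hΦ.sum _ hcs).trans (Finset.sum_congr rfl fun i _ ↦ hΦ.smul (hc i) (hs i))
  rw [expand hZ, expand hZ', h]

end SmoothTensorialAt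

end Tensoriality

section Curvature

variable [FiniteDimensional ℝ E] [IsManifold I ∞ M]

theorem leviCivita_add (g : RiemMetric I M) {Y Y' : Π x : M, TangentSpace I x} {x : M}
    (hY : MDiffAt (T% Y) x) (hY' : MDiffAt (T% Y') x) (u : TangentSpace I x) :
    leviCivita g (Y + Y') x u = leviCivita g Y x u + leviCivita g Y' x u := by
  rw [(leviCivita g).isCovariantDerivativeOnUniv.add hY hY', add_apply]

theorem leviCivita_smul (g : RiemMetric I M) {f : M → ℝ} {Y : Π x : M, TangentSpace I x} {x : M}
    (hf : MDiffAt f x) (hY : MDiffAt (T% Y) x) (u : TangentSpace I x) :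
    leviCivita g (f • Y) x u = f x • leviCivita g Y x u + mvfderiv I f x u • Y x := by
  rw [(leviCivita g).isCovariantDerivativeOnUniv.leibniz hY hf]
  rfl

theorem leviCivita_congr (g : RiemMetric I M) {Y Y' : Π x : M, TangentSpace I x} {x : M}
    (hY : MDiffAt (T% Y) x) (hY' : MDiffAt (T% Y') x) (h : Y =ᶠ[𝓝 x] Y') :
    leviCivita g Y x = leviCivita g Y' x :=
  (leviCivita g).isCovariantDerivativeOnUniv.congr_of_eventuallyEq hY hY' Filter.univ_mem h

theorem leviCivita_leviCivita_add (g : RiemMetric I M) {Y Z Z' : Π x : M, TangentSpace I x} {x : M}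
    (hY : CMDiffAt ∞ (T% Y) x) (hZ : CMDiffAt ∞ (T% Z) x) (hZ' : CMDiffAt ∞ (T% Z') x)
    (u : TangentSpace I x) :
    leviCivita g (fun y ↦ leviCivita g (Z + Z') y (Y y)) x u
      = leviCivita g (fun y ↦ leviCivita g Z y (Y y)) x u
        + leviCivita g (fun y ↦ leviCivita g Z' y (Y y)) x u := by
  have hYZ := contMDiffAt_leviCivita g hY hZ
  have hYZ' := contMDiffAt_leviCivita g hY hZ'
  have hYsum := contMDiffAt_leviCivita g hY (hZ.add_section hZ')
  rw [← leviCivita_add g (mdifferentiableAt_of_smoothAt hYZ) (mdifferentiableAt_of_smoothAt hYZ')]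
  refine DFunLike.congr_fun (leviCivita_congr g (mdifferentiableAt_of_smoothAt hYsum)
    (mdifferentiableAt_of_smoothAt (hYZ.add_section hYZ')) ?_) u
  filter_upwards [eventually_mdifferentiableAt_of_smoothAt hZ,
    eventually_mdifferentiableAt_of_smoothAt hZ'] with y hZy hZy'
  exact leviCivita_add g hZy hZy' _

theorem leviCivita_leviCivita_smul (g : RiemMetric I M) {f : M → ℝ}
    {X Y Z : Π x : M, TangentSpace I x} {x : M} (hY : CMDiffAt ∞ (T% Y) x)
    (hZ : CMDiffAt ∞ (T% Z) x) (hf : CMDiffAt ∞ f x) :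
    leviCivita g (fun y ↦ leviCivita g (f • Z) y (Y y)) x (X x)
      = f x • leviCivita g (fun y ↦ leviCivita g Z y (Y y)) x (X x)
        + dirDeriv X f x • leviCivita g Z x (Y x) + dirDeriv Y f x • leviCivita g Z x (X x)
        + dirDeriv X (dirDeriv Y f) x • Z x := by
  have hYZ := contMDiffAt_leviCivita g hY hZ
  have hYf := contMDiffAt_dirDeriv hY hf
  have hYfZ := contMDiffAt_leviCivita g hY (hf.smul_section hZ)
  have hfYZ := hf.smul_section hYZ
  have hYf_Z := hYf.smul_section hZ
  have hleibniz : (fun y ↦ leviCivita g (f • Z) y (Y y))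
      =ᶠ[𝓝 x] f • (fun y ↦ leviCivita g Z y (Y y)) + dirDeriv Y f • Z := by
    filter_upwards [eventually_mdifferentiableAt_of_smoothAt hZ,
      eventually_mdifferentiableAt_of_smoothAt hf] with y hZy hfy
    exact leviCivita_smul g hfy hZy _
  rw [leviCivita_congr g (mdifferentiableAt_of_smoothAt hYfZ)
      (mdifferentiableAt_of_smoothAt (hfYZ.add_section hYf_Z)) hleibniz,
    leviCivita_add g (mdifferentiableAt_of_smoothAt hfYZ) (mdifferentiableAt_of_smoothAt hYf_Z),
    leviCivita_smul g (mdifferentiableAt_of_smoothAt hf) (mdifferentiableAt_of_smoothAt hYZ),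
    leviCivita_smul g (mdifferentiableAt_of_smoothAt hYf) (mdifferentiableAt_of_smoothAt hZ)]
  simp only [dirDeriv]
  abel

theorem curvature_add (g : RiemMetric I M) {X Y Z Z' : Π x : M, TangentSpace I x} {x : M}
    (hX : CMDiffAt ∞ (T% X) x) (hY : CMDiffAt ∞ (T% Y) x) (hZ : CMDiffAt ∞ (T% Z) x)
    (hZ' : CMDiffAt ∞ (T% Z') x) :
    curvature g X Y (Z + Z') x = curvature g X Y Z x + curvature g X Y Z' x := by
  rw [curvature, leviCivita_leviCivita_add g hY hZ hZ', leviCivita_leviCivita_add g hX hZ hZ',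
    leviCivita_add g (mdifferentiableAt_of_smoothAt hZ) (mdifferentiableAt_of_smoothAt hZ'),
    curvature, curvature]
  abel

theorem curvature_smul (g : RiemMetric I M) {f : M → ℝ} {X Y Z : Π x : M, TangentSpace I x} {x : M}
    (hX : CMDiffAt ∞ (T% X) x) (hY : CMDiffAt ∞ (T% Y) x) (hf : CMDiffAt ∞ f x)
    (hZ : CMDiffAt ∞ (T% Z) x) : curvature g X Y (f • Z) x = f x • curvature g X Y Z x := by
  have : CompleteSpace E := FiniteDimensional.complete ℝ E
  have hbracket : mvfderiv I f x (mlieBracket I X Y x)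
      = dirDeriv X (dirDeriv Y f) x - dirDeriv Y (dirDeriv X f) x := dirDeriv_mlieBracket hX hY hf
  rw [curvature, leviCivita_leviCivita_smul g hY hZ hf, leviCivita_leviCivita_smul g hX hZ hf,
    leviCivita_smul g (mdifferentiableAt_of_smoothAt hf) (mdifferentiableAt_of_smoothAt hZ),
    hbracket, curvature]
  module

theorem smoothTensorialAt_curvature (g : RiemMetric I M) {X Y : Π x : M, TangentSpace I x} {x : M}
    (hX : CMDiffAt ∞ (T% X) x) (hY : CMDiffAt ∞ (T% Y) x) :
    SmoothTensorialAt (fun Z ↦ curvature g X Y Z x) x where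
  add := curvature_add g hX hY
  smul := curvature_smul g hX hY

end Curvature

section LeviCivita

variable [FiniteDimensional ℝ E] [IsManifold I ∞ M]

theorem mvfderiv_pairing (g : RiemMetric I M) {Y Z : Π x : M, TangentSpace I x} {x : M}
    (hY : MDiffAt (T% Y) x) (hZ : MDiffAt (T% Z) x) (u : TangentSpace I x) :
    mvfderiv I (pairing g Y Z) x u
      = g.inner x (leviCivita g Y x u) (Z x) + g.inner x (Y x) (leviCivita g Z x u) := by
  simpa only [dirDeriv, extend_apply_self] using
    leviCivita_metric g (mdifferentiableAt_extend I E u) hY hZ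

theorem leviCivita_eq_of_torsionFree_of_metric (g : RiemMetric I M) {x : M}
    {D : (Π y : M, TangentSpace I y) → TangentSpace I x → TangentSpace I x}
    (torsionFree : ∀ {X Y : Π y : M, TangentSpace I y}, MDiffAt (T% X) x → MDiffAt (T% Y) x →
      D Y (X x) - D X (Y x) = mlieBracket I X Y x)
    (metric : ∀ {Y Z : Π y : M, TangentSpace I y}, MDiffAt (T% Y) x → MDiffAt (T% Z) x → ∀ u,
      mvfderiv I (pairing g Y Z) x u = g.inner x (D Y u) (Z x) + g.inner x (Y x) (D Z u))
    {Y : Π y : M, TangentSpace I y} (hY : MDiffAt (T% Y) x) (u : TangentSpace I x) :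
    leviCivita g Y x u = D Y u := by
  let A (Y : Π y : M, TangentSpace I y) (u : TangentSpace I x) := leviCivita g Y x u - D Y u
  have symm {X Y : Π y : M, TangentSpace I y} (hX : MDiffAt (T% X) x) (hY : MDiffAt (T% Y) x) :
      A X (Y x) = A Y (X x) := by
    have h := (leviCivita_torsion_free g hX hY).trans (torsionFree hX hY).symm
    rw [← sub_eq_zero] at h ⊢
    rw [← neg_eq_zero, ← h]
    simp only [A]
    abel
  have skew {Y Z : Π y : M, TangentSpace I y} (hY : MDiffAt (T% Y) x) (hZ : MDiffAt (T% Z) x)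
      (u : TangentSpace I x) : g.inner x (A Y u) (Z x) = -g.inner x (A Z u) (Y x) := by
    have h := (mvfderiv_pairing g hY hZ u).symm.trans (metric hY hZ u)
    rw [g.symm x (Y x), g.symm x (Y x)] at h
    simp only [A, map_sub, sub_apply]
    linear_combination h
  -- A trilinear form symmetric in one pair of arguments and skew in an overlapping one vanishes.
  refine inner_ext g fun w ↦ sub_eq_zero.1 ?_
  let U : Π y : M, TangentSpace I y := extend E u
  let W : Π y : M, TangentSpace I y := extend E w
  have hU : MDiffAt (T% U) x := mdifferentiableAt_extend I E u
  have hW : MDiffAt (T% W) x := mdifferentiableAt_extend I E w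
  have braid : g.inner x (A Y (U x)) (W x) = -g.inner x (A Y (U x)) (W x) :=
    calc
      g.inner x (A Y (U x)) (W x) = -g.inner x (A U (W x)) (Y x) := by
        rw [skew hY hW, symm hW hU]
      _ = g.inner x (A W (Y x)) (U x) := by rw [skew hU hY, symm hY hW, neg_neg]
      _ = -g.inner x (A Y (U x)) (W x) := by rw [skew hW hU, symm hU hY]
  have hzero : g.inner x (A Y (U x)) (W x) = 0 := self_eq_neg.1 braid
  simpa only [A, U, W, extend_apply_self, map_sub, sub_apply] using hzero

theorem lieDerivMetric_eq (g : RiemMetric I M) {V X Y : Π x : M, TangentSpace I x} {x : M}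
    (hV : MDiffAt (T% V) x) (hX : MDiffAt (T% X) x) (hY : MDiffAt (T% Y) x) :
    lieDerivMetric g V X Y x
      = g.inner x (leviCivita g V x (X x)) (Y x) + g.inner x (leviCivita g V x (Y x)) (X x) := by
  rw [lieDerivMetric, leviCivita_metric g hV hX hY, ← leviCivita_torsion_free g hV hX,
    ← leviCivita_torsion_free g hV hY, g.symm x (leviCivita g V x (Y x))]
  simp

theorem IsAlmostRicciSoliton.ricci_eq {g : RiemMetric I M} {V : Π x : M, TangentSpace I x}
    {lam : M → ℝ} (h : IsAlmostRicciSoliton g V lam) (x : M) (u v : TangentSpace I x) :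
    ricci g x u v = lam x * g.inner x u v
      - 1 / 2 * (g.inner x (leviCivita g V x u) v + g.inner x (leviCivita g V x v) u) := by
  have heq := h.equation x _ _ (contMDiffAt_extend I E u) (contMDiffAt_extend I E v)
  rw [lieDerivMetric_eq g (mdifferentiableAt_of_smoothAt (h.smooth_field x))
    (mdifferentiableAt_extend I E u) (mdifferentiableAt_extend I E v)] at heq
  simp only [extend_apply_self] at heq
  linear_combination heq

end LeviCivita

section Trace

theorem sum_coord_apply_eq_trace {ι R V : Type*} [Fintype ι] [CommRing R] [AddCommGroup V]
    [Module R V] (b : Module.Basis ι R V) (L : V →ₗ[R] V) :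
    ∑ i, b.coord i (L (b i)) = LinearMap.trace R V L := by
  classical
  simp [LinearMap.trace_eq_matrix_trace R b, Matrix.trace, LinearMap.toMatrix_apply]

variable [FiniteDimensional ℝ E] [IsManifold I ∞ M]

theorem ricci_eq_trace (g : RiemMetric I M) {x : M} {u v : TangentSpace I x}
    {L : TangentSpace I x →ₗ[ℝ] TangentSpace I x}
    (h : ∀ w, curvature g (extend E w) (extend E u) (extend E v) x = L w) :
    ricci g x u v = LinearMap.trace ℝ (TangentSpace I x) L := by
  simp only [ricci, h, sum_coord_apply_eq_trace]

theorem ricci_eq_ricci_add_trace (g g' : RiemMetric I M) {x : M} {u v : TangentSpace I x}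
    {L : TangentSpace I x →ₗ[ℝ] TangentSpace I x}
    (h : ∀ w, curvature g' (extend E w) (extend E u) (extend E v) x
      = curvature g (extend E w) (extend E u) (extend E v) x + L w) :
    ricci g' x u v = ricci g x u v + LinearMap.trace ℝ (TangentSpace I x) L := by
  simp only [ricci, h, map_add, Finset.sum_add_distrib, sum_coord_apply_eq_trace]

theorem sum_inner_apply_onb (g : RiemMetric I M) (x : M)
    (T : TangentSpace I x →ₗ[ℝ] TangentSpace I x) :
    ∑ i, g.inner x (T (onb g x i)) (onb g x i) = LinearMap.trace ℝ (TangentSpace I x) T := by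
  let _ : RiemannianBundle (TangentSpace I : M → Type _) := ⟨g.toRiemannianMetric⟩
  rw [LinearMap.trace_eq_sum_inner T (stdOrthonormalBasis ℝ (TangentSpace I x))]
  exact Finset.sum_congr rfl fun i _ ↦ g.symm x _ _

theorem scal_eq_trace (g : RiemMetric I M) {x : M} {Q : TangentSpace I x →ₗ[ℝ] TangentSpace I x}
    (h : ∀ u, ricci g x u u = g.inner x (Q u) u) :
    scal g x = LinearMap.trace ℝ (TangentSpace I x) Q := by
  simp only [scal, h, sum_inner_apply_onb]

end Trace

section Deformation

variable [IsManifold I ∞ M]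

namespace AlmostContactMetric

theorem φ_ξ (S : AlmostContactMetric I M) (x : M) : S.φ x (S.ξ x) = 0 := by
  by_contra hne
  have hpos := S.g.pos x _ hne
  simp [S.compat, ← S.η_eq, S.η_ξ] at hpos

theorem η_apply_eq_pairing (S : AlmostContactMetric I M) (Y : Π x : M, TangentSpace I x) :
    (fun y ↦ S.η y (Y y)) = pairing S.g S.ξ Y :=
  funext fun y ↦ S.η_eq y (Y y)

theorem mdiffAt_ξ (S : AlmostContactMetric I M) (x : M) : MDiffAt (T% S.ξ) x :=
  mdifferentiableAt_of_smoothAt (S.smooth_ξ x)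

theorem contMDiffAt_η_apply (S : AlmostContactMetric I M) {Y : Π x : M, TangentSpace I x} {x : M}
    (hY : CMDiffAt ∞ (T% Y) x) : CMDiffAt ∞ (fun y ↦ S.η y (Y y)) x := by
  rw [S.η_apply_eq_pairing]
  exact contMDiffAt_pairing S.g (S.smooth_ξ x) hY

/-- The degenerate metric `g - η ⊗ η`, which is `g` on the contact distribution `ker η` and has the
Reeb field in its kernel. The deformed metric is `a (g - η ⊗ η) + a² η ⊗ η`. -/
noncomputable def transverseMetric (S : AlmostContactMetric I M) (x : M) :
    TangentSpace I x →L[ℝ] TangentSpace I x →L[ℝ] ℝ :=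
  S.g.inner x - S.etaSq x

theorem transverseMetric_apply (S : AlmostContactMetric I M) (x : M) (u v : TangentSpace I x) :
    S.transverseMetric x u v = S.g.inner x u v - S.η x u * S.η x v := by
  simp [transverseMetric, etaSq]

theorem transverseMetric_symm (S : AlmostContactMetric I M) (x : M) (u v : TangentSpace I x) :
    S.transverseMetric x u v = S.transverseMetric x v u := by
  rw [transverseMetric_apply, transverseMetric_apply, S.g.symm, mul_comm]

@[simp]
theorem transverseMetric_ξ_left (S : AlmostContactMetric I M) (x : M) (v : TangentSpace I x) :
    S.transverseMetric x (S.ξ x) v = 0 := by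
  rw [transverseMetric_apply, ← S.η_eq, S.η_ξ, one_mul, sub_self]

@[simp]
theorem transverseMetric_ξ_right (S : AlmostContactMetric I M) (x : M) (u : TangentSpace I x) :
    S.transverseMetric x u (S.ξ x) = 0 := by
  rw [transverseMetric_symm, transverseMetric_ξ_left]

theorem transverseMetric_apply_eq_pairing_sub (S : AlmostContactMetric I M)
    (Y Z : Π x : M, TangentSpace I x) :
    (fun y ↦ S.transverseMetric y (Y y) (Z y))
      = pairing S.g Y Z - (fun y ↦ S.η y (Y y)) * fun y ↦ S.η y (Z y) :=
  funext fun y ↦ S.transverseMetric_apply y (Y y) (Z y)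

theorem contMDiffAt_transverseMetric_apply (S : AlmostContactMetric I M)
    {Y Z : Π x : M, TangentSpace I x} {x : M} (hY : CMDiffAt ∞ (T% Y) x)
    (hZ : CMDiffAt ∞ (T% Z) x) :
    CMDiffAt ∞ (fun y ↦ S.transverseMetric y (Y y) (Z y)) x := by
  rw [S.transverseMetric_apply_eq_pairing_sub]
  exact (contMDiffAt_pairing S.g hY hZ).sub
    ((S.contMDiffAt_η_apply hY).mul (S.contMDiffAt_η_apply hZ))

variable [FiniteDimensional ℝ E]

theorem mdiffAt_η_apply (S : AlmostContactMetric I M) {Y : Π x : M, TangentSpace I x} {x : M}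
    (hY : MDiffAt (T% Y) x) : MDiffAt (fun y ↦ S.η y (Y y)) x := by
  rw [S.η_apply_eq_pairing]
  exact mdiffAt_pairing S.g (S.mdiffAt_ξ x) hY

theorem mdiffAt_transverseMetric_apply (S : AlmostContactMetric I M)
    {Y Z : Π x : M, TangentSpace I x} {x : M} (hY : MDiffAt (T% Y) x) (hZ : MDiffAt (T% Z) x) :
    MDiffAt (fun y ↦ S.transverseMetric y (Y y) (Z y)) x := by
  rw [S.transverseMetric_apply_eq_pairing_sub]
  exact (mdiffAt_pairing S.g hY hZ).sub ((S.mdiffAt_η_apply hY).mul (S.mdiffAt_η_apply hZ))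

theorem mvfderiv_η_apply (S : AlmostContactMetric I M) {Y : Π x : M, TangentSpace I x} {x : M}
    (hY : MDiffAt (T% Y) x) (u : TangentSpace I x) :
    mvfderiv I (fun y ↦ S.η y (Y y)) x u
      = S.g.inner x (leviCivita S.g S.ξ x u) (Y x) + S.η x (leviCivita S.g Y x u) := by
  rw [S.η_apply_eq_pairing, mvfderiv_pairing S.g (S.mdiffAt_ξ x) hY, S.η_eq]

theorem η_leviCivita_ξ (S : AlmostContactMetric I M) (x : M) (u : TangentSpace I x) :
    S.η x (leviCivita S.g S.ξ x u) = 0 := by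
  have h := S.mvfderiv_η_apply (S.mdiffAt_ξ x) u
  have hone : (fun y ↦ S.η y (S.ξ y)) = fun _ ↦ (1 : ℝ) := funext S.η_ξ
  rw [hone, mvfderiv_const, zero_apply, S.g.symm, ← S.η_eq] at h
  linarith

theorem deform_inner (S : AlmostContactMetric I M) (a : ℝ) (ha : 0 < a) (x : M)
    (u v : TangentSpace I x) :
    (S.deform a ha).g.inner x u v
      = a * S.transverseMetric x u v + a ^ 2 * (S.η x u * S.η x v) := by
  simp only [deform, deformMetric, etaSq, transverseMetric_apply, add_apply, smul_apply,
    ContinuousLinearMap.smulRight_apply, smul_eq_mul]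
  ring

theorem mvfderiv_pairing_deform (S : AlmostContactMetric I M) {a : ℝ} (ha : 0 < a)
    {Y Z : Π x : M, TangentSpace I x} {x : M} (hY : MDiffAt (T% Y) x) (hZ : MDiffAt (T% Z) x)
    (u : TangentSpace I x) :
    mvfderiv I (pairing (S.deform a ha).g Y Z) x u
      = a * mvfderiv I (fun y ↦ S.transverseMetric y (Y y) (Z y)) x u
        + a ^ 2 * (S.η x (Y x) * mvfderiv I (fun y ↦ S.η y (Z y)) x u
          + S.η x (Z x) * mvfderiv I (fun y ↦ S.η y (Y y)) x u) := by
  have hηY := S.mdiffAt_η_apply hY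
  have hηZ := S.mdiffAt_η_apply hZ
  have hh := S.mdiffAt_transverseMetric_apply hY hZ
  have hconst (r : ℝ) : MDiffAt (fun _ : M ↦ r) x := mdifferentiableAt_const
  have hpair : pairing (S.deform a ha).g Y Z
      = (fun _ ↦ a) * (fun y ↦ S.transverseMetric y (Y y) (Z y))
        + (fun _ ↦ a ^ 2) * ((fun y ↦ S.η y (Y y)) * fun y ↦ S.η y (Z y)) :=
    funext fun y ↦ S.deform_inner a ha y _ _
  rw [hpair, mvfderiv_add ((hconst a).mul hh) ((hconst _).mul (hηY.mul hηZ)),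
    mvfderiv_mul (hconst a) hh, mvfderiv_mul (hconst _) (hηY.mul hηZ), mvfderiv_mul hηY hηZ,
    mvfderiv_const, mvfderiv_const]
  simp only [add_apply, smul_apply, smul_eq_mul, smul_zero, add_zero]

/-- The Reeb field is torse-forming, `∇_u ξ = u - η(u) ξ`, as it is on a Kenmotsu manifold. This
equation on `∇ξ` alone determines how the connection changes under a deformation. -/
def IsTorseForming (S : AlmostContactMetric I M) : Prop :=
  ∀ (x : M) (u : TangentSpace I x), leviCivita S.g S.ξ x u = u - S.η x u • S.ξ x

theorem IsKenmotsu.isTorseForming {S : AlmostContactMetric I M} (hS : S.IsKenmotsu) :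
    S.IsTorseForming := by
  intro x u
  have hφ : S.φ x (leviCivita S.g S.ξ x u) = S.φ x u := by
    have h := hS S.ξ S.smooth_ξ x u
    have hφξ : (fun y ↦ S.φ y (S.ξ y)) = (0 : Π x : M, TangentSpace I x) := funext S.φ_ξ
    have hzero : leviCivita S.g (0 : Π x : M, TangentSpace I x) x u = 0 := by simp
    rw [hφξ, hzero, S.g.symm, ← S.η_eq, S.η_φ, S.η_ξ] at h
    simpa using h
  have hφφ := congrArg (S.φ x) hφ
  rw [S.φ_sq, S.φ_sq, S.η_leviCivita_ξ, zero_smul, add_zero] at hφφ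
  rw [← neg_inj, hφφ]
  abel

namespace IsTorseForming

variable {S : AlmostContactMetric I M} {X Y Z : Π x : M, TangentSpace I x} {x : M} {a : ℝ}

theorem mvfderiv_η_apply (hS : S.IsTorseForming) (hY : MDiffAt (T% Y) x) (u : TangentSpace I x) :
    mvfderiv I (fun y ↦ S.η y (Y y)) x u
      = S.η x (leviCivita S.g Y x u) + S.transverseMetric x u (Y x) := by
  rw [S.mvfderiv_η_apply hY, hS, S.transverseMetric_apply]
  simp only [map_sub, map_smul, sub_apply, smul_apply, smul_eq_mul, ← S.η_eq]
  ring

theorem mvfderiv_transverseMetric_apply (hS : S.IsTorseForming) (hY : MDiffAt (T% Y) x)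
    (hZ : MDiffAt (T% Z) x) (u : TangentSpace I x) :
    mvfderiv I (fun y ↦ S.transverseMetric y (Y y) (Z y)) x u
      = S.transverseMetric x (leviCivita S.g Y x u) (Z x)
        + S.transverseMetric x (Y x) (leviCivita S.g Z x u)
        - S.transverseMetric x u (Y x) * S.η x (Z x)
        - S.transverseMetric x u (Z x) * S.η x (Y x) := by
  have hηY := S.mdiffAt_η_apply hY
  have hηZ := S.mdiffAt_η_apply hZ
  rw [S.transverseMetric_apply_eq_pairing_sub,
    mvfderiv_sub (mdiffAt_pairing S.g hY hZ) (hηY.mul hηZ), mvfderiv_mul hηY hηZ]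
  simp only [sub_apply, add_apply, smul_apply, smul_eq_mul, mvfderiv_pairing S.g hY hZ,
    hS.mvfderiv_η_apply hY, hS.mvfderiv_η_apply hZ, S.transverseMetric_apply]
  ring

theorem leviCivita_deform (hS : S.IsTorseForming) (ha : 0 < a) (hY : MDiffAt (T% Y) x)
    (u : TangentSpace I x) :
    leviCivita (S.deform a ha).g Y x u
      = leviCivita S.g Y x u + ((1 - 1 / a) * S.transverseMetric x u (Y x)) • S.ξ x := by
  refine leviCivita_eq_of_torsionFree_of_metric (S.deform a ha).g (D := fun Y u ↦
    leviCivita S.g Y x u + ((1 - 1 / a) * S.transverseMetric x u (Y x)) • S.ξ x) ?_ ?_ hY u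
  · intro X Y hX hY
    rw [← leviCivita_torsion_free S.g hX hY, S.transverseMetric_symm x (X x)]
    abel
  · intro Y Z hY hZ u
    rw [S.mvfderiv_pairing_deform ha hY hZ, hS.mvfderiv_transverseMetric_apply hY hZ,
      hS.mvfderiv_η_apply hY, hS.mvfderiv_η_apply hZ]
    simp only [S.deform_inner, map_add, map_smul, add_apply, smul_apply, smul_eq_mul, S.η_ξ,
      transverseMetric_ξ_left, transverseMetric_ξ_right]
    field_simp
    ring

theorem leviCivita_leviCivita_deform (hS : S.IsTorseForming) (ha : 0 < a)
    (hY : CMDiffAt ∞ (T% Y) x) (hZ : CMDiffAt ∞ (T% Z) x) (u : TangentSpace I x) :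
    leviCivita (S.deform a ha).g (fun y ↦ leviCivita (S.deform a ha).g Z y (Y y)) x u
      = leviCivita S.g (fun y ↦ leviCivita S.g Z y (Y y)) x u
        + (1 - 1 / a) • (S.transverseMetric x (Y x) (Z x) • (u - S.η x u • S.ξ x)
          + (mvfderiv I (fun y ↦ S.transverseMetric y (Y y) (Z y)) x u
            + S.transverseMetric x u (leviCivita S.g Z x (Y x))) • S.ξ x) := by
  let h : M → ℝ := fun y ↦ S.transverseMetric y (Y y) (Z y)
  let f : M → ℝ := (fun _ ↦ 1 - 1 / a) * h
  let W : Π x : M, TangentSpace I x := fun y ↦ leviCivita S.g Z y (Y y)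
  have hh : CMDiffAt ∞ h x := S.contMDiffAt_transverseMetric_apply hY hZ
  have hW : CMDiffAt ∞ (T% W) x := contMDiffAt_leviCivita S.g hY hZ
  have hf : CMDiffAt ∞ f x := contMDiffAt_const.mul hh
  have hfξ : CMDiffAt ∞ (T% (f • S.ξ)) x := hf.smul_section (S.smooth_ξ x)
  have hdf : mvfderiv I f x u = (1 - 1 / a) * mvfderiv I h x u := by
    rw [mvfderiv_mul mdifferentiableAt_const (mdifferentiableAt_of_smoothAt hh), mvfderiv_const]
    simp only [smul_zero, add_zero, smul_apply, smul_eq_mul]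
  have hdeform : (fun y ↦ leviCivita (S.deform a ha).g Z y (Y y)) =ᶠ[𝓝 x] W + f • S.ξ := by
    filter_upwards [eventually_mdifferentiableAt_of_smoothAt hZ] with y hZy
    exact hS.leviCivita_deform ha hZy (Y y)
  have hWfξ := mdifferentiableAt_of_smoothAt (hW.add_section hfξ)
  rw [leviCivita_congr _ (mdifferentiableAt_of_smoothAt (contMDiffAt_leviCivita _ hY hZ)) hWfξ
      hdeform, hS.leviCivita_deform ha hWfξ,
    leviCivita_add S.g (mdifferentiableAt_of_smoothAt hW) (mdifferentiableAt_of_smoothAt hfξ),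
    leviCivita_smul S.g (mdifferentiableAt_of_smoothAt hf) (S.mdiffAt_ξ x), hdf, hS]
  simp only [W, f, h, Pi.add_apply, Pi.smul_apply', Pi.mul_apply, map_add, map_smul,
    transverseMetric_ξ_right, smul_zero, add_zero]
  module

theorem curvature_deform (hS : S.IsTorseForming) (ha : 0 < a) (hX : CMDiffAt ∞ (T% X) x)
    (hY : CMDiffAt ∞ (T% Y) x) (hZ : CMDiffAt ∞ (T% Z) x) :
    curvature (S.deform a ha).g X Y Z x = curvature S.g X Y Z x
      + (1 - 1 / a) • (S.transverseMetric x (Y x) (Z x) • X x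
        - S.transverseMetric x (X x) (Z x) • Y x) := by
  have hXd := mdifferentiableAt_of_smoothAt hX
  have hYd := mdifferentiableAt_of_smoothAt hY
  have hZd := mdifferentiableAt_of_smoothAt hZ
  have hbracket : S.transverseMetric x (mlieBracket I X Y x) (Z x)
      = S.transverseMetric x (leviCivita S.g Y x (X x)) (Z x)
        - S.transverseMetric x (leviCivita S.g X x (Y x)) (Z x) := by
    rw [← leviCivita_torsion_free S.g hXd hYd, map_sub, sub_apply]
  rw [curvature, hS.leviCivita_leviCivita_deform ha hY hZ,
    hS.leviCivita_leviCivita_deform ha hX hZ, hS.leviCivita_deform ha hZd, hbracket,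
    hS.mvfderiv_transverseMetric_apply hYd hZd, hS.mvfderiv_transverseMetric_apply hXd hZd,
    S.transverseMetric_symm x (Y x) (X x), curvature]
  module

theorem ricci_deform (hS : S.IsTorseForming) (ha : 0 < a) (x : M) (u v : TangentSpace I x) :
    ricci (S.deform a ha).g x u v = ricci S.g x u v
      + (Module.finrank ℝ E - 1) * (1 - 1 / a) * S.transverseMetric x u v := by
  let L : TangentSpace I x →ₗ[ℝ] TangentSpace I x := (1 - 1 / a) •
    (S.transverseMetric x u v • LinearMap.id
      - (S.transverseMetric x v : TangentSpace I x →ₗ[ℝ] ℝ).smulRight u)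
  have hL (w : TangentSpace I x) : curvature (S.deform a ha).g (extend E w) (extend E u)
      (extend E v) x = curvature S.g (extend E w) (extend E u) (extend E v) x + L w := by
    rw [hS.curvature_deform ha (contMDiffAt_extend I E w) (contMDiffAt_extend I E u)
      (contMDiffAt_extend I E v)]
    simp [L, S.transverseMetric_symm x w v]
  have hfinrank : Module.finrank ℝ (TangentSpace I x) = Module.finrank ℝ E := rfl
  rw [ricci_eq_ricci_add_trace S.g _ hL, map_smul, map_sub, map_smul, LinearMap.trace_id,
    LinearMap.trace_smulRight, hfinrank, ContinuousLinearMap.coe_coe, S.transverseMetric_symm x v]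
  simp only [smul_eq_mul]
  ring

theorem leviCivita_leviCivita_ξ (hS : S.IsTorseForming) (hY : MDiffAt (T% Y) x)
    (u : TangentSpace I x) :
    leviCivita S.g (fun y ↦ leviCivita S.g S.ξ y (Y y)) x u
      = leviCivita S.g Y x u - S.η x (Y x) • (u - S.η x u • S.ξ x)
        - (S.η x (leviCivita S.g Y x u) + S.transverseMetric x u (Y x)) • S.ξ x := by
  have hηY : MDiffAt (-(fun y ↦ S.η y (Y y))) x := (S.mdiffAt_η_apply hY).neg
  have hξ : (fun y ↦ leviCivita S.g S.ξ y (Y y)) = Y + (-(fun y ↦ S.η y (Y y))) • S.ξ := by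
    ext1 y
    rw [hS]
    simp [sub_eq_add_neg]
  rw [hξ, leviCivita_add S.g hY (hηY.smul_section (S.mdiffAt_ξ x)),
    leviCivita_smul S.g hηY (S.mdiffAt_ξ x), mvfderiv_neg, hS, neg_apply, hS.mvfderiv_η_apply hY,
    Pi.neg_apply]
  module

theorem curvature_ξ (hS : S.IsTorseForming) (hX : MDiffAt (T% X) x) (hY : MDiffAt (T% Y) x) :
    curvature S.g X Y S.ξ x = S.η x (X x) • Y x - S.η x (Y x) • X x := by
  rw [curvature, hS.leviCivita_leviCivita_ξ hY, hS.leviCivita_leviCivita_ξ hX, hS,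
    ← leviCivita_torsion_free S.g hX hY, map_sub, S.transverseMetric_symm x (Y x)]
  module

theorem ricci_ξ_ξ (hS : S.IsTorseForming) (x : M) :
    ricci S.g x (S.ξ x) (S.ξ x) = 1 - Module.finrank ℝ E := by
  let L : TangentSpace I x →ₗ[ℝ] TangentSpace I x :=
    (S.η x : TangentSpace I x →ₗ[ℝ] ℝ).smulRight (S.ξ x) - LinearMap.id
  have hL (w : TangentSpace I x) :
      curvature S.g (extend E w) (extend E (S.ξ x)) (extend E (S.ξ x)) x = L w := by
    have htensorial := smoothTensorialAt_curvature S.g (contMDiffAt_extend I E w)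
      (contMDiffAt_extend I E (S.ξ x))
    rw [htensorial.eq_of_eq (contMDiffAt_extend I E _) (S.smooth_ξ x) (extend_apply_self ..),
      hS.curvature_ξ (mdifferentiableAt_extend I E w) (mdifferentiableAt_extend I E (S.ξ x))]
    simp [L, S.η_ξ]
  have hfinrank : Module.finrank ℝ (TangentSpace I x) = Module.finrank ℝ E := rfl
  rw [ricci_eq_trace S.g hL, map_sub, LinearMap.trace_smulRight, LinearMap.trace_id, hfinrank,
    ContinuousLinearMap.coe_coe, S.η_ξ]

end IsTorseForming

end AlmostContactMetric

end Deformation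

section Soliton

namespace AlmostContactMetric.IsTorseForming

variable [FiniteDimensional ℝ E] [IsManifold I ∞ M] {S : AlmostContactMetric I M} {a : ℝ}
  {ha : 0 < a} {V : Π x : M, TangentSpace I x} {lam : M → ℝ}

theorem dirDeriv_ξ_η_apply (hS : S.IsTorseForming) {x : M} (hV : MDiffAt (T% V) x) :
    dirDeriv S.ξ (fun y ↦ S.η y (V y)) x = S.η x (leviCivita S.g V x (S.ξ x)) := by
  rw [dirDeriv, hS.mvfderiv_η_apply hV, S.transverseMetric_ξ_left, add_zero]

theorem leviCivita_deform_ξ (hS : S.IsTorseForming) (ha : 0 < a) {x : M} (hV : MDiffAt (T% V) x) :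
    leviCivita (S.deform a ha).g V x (S.ξ x) = leviCivita S.g V x (S.ξ x) := by
  rw [hS.leviCivita_deform ha hV, S.transverseMetric_ξ_left, mul_zero, zero_smul, add_zero]

theorem ricci_eq_deform_inner_of_soliton (hS : S.IsTorseForming)
    (hsol : IsAlmostRicciSoliton (S.deform a ha).g V lam) (x : M) (u v : TangentSpace I x) :
    ricci S.g x u v = lam x * (S.deform a ha).g.inner x u v
      - 1 / 2 * ((S.deform a ha).g.inner x (leviCivita (S.deform a ha).g V x u) v
        + (S.deform a ha).g.inner x (leviCivita (S.deform a ha).g V x v) u)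
      - (Module.finrank ℝ E - 1) * (1 - 1 / a) * S.transverseMetric x u v := by
  rw [← hsol.ricci_eq, hS.ricci_deform ha]
  ring

theorem soliton_function_eq (hS : S.IsTorseForming)
    (hsol : IsAlmostRicciSoliton (S.deform a ha).g V lam) (x : M) :
    lam x = dirDeriv S.ξ (fun y ↦ S.η y (V y)) x - (Module.finrank ℝ E - 1) / a ^ 2 := by
  have hV := mdifferentiableAt_of_smoothAt (hsol.smooth_field x)
  have h := hS.ricci_eq_deform_inner_of_soliton hsol x (S.ξ x) (S.ξ x)
  simp only [hS.ricci_ξ_ξ, hS.leviCivita_deform_ξ ha hV, S.deform_inner, S.η_ξ,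
    S.transverseMetric_ξ_left, S.transverseMetric_ξ_right, ← hS.dirDeriv_ξ_η_apply hV] at h
  field_simp
  linear_combination -h

theorem scal_eq_of_soliton (hS : S.IsTorseForming)
    (hsol : IsAlmostRicciSoliton (S.deform a ha).g V lam) (x : M) :
    scal S.g x = Module.finrank ℝ E *
        (a * dirDeriv S.ξ (fun y ↦ S.η y (V y)) x - (Module.finrank ℝ E - 1))
      - a * divergence (S.deform a ha).g V x := by
  have hV := mdifferentiableAt_of_smoothAt (hsol.smooth_field x)
  let N : ℝ := Module.finrank ℝ E
  let A : TangentSpace I x →ₗ[ℝ] TangentSpace I x := leviCivita (S.deform a ha).g V x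
  let ηξ : TangentSpace I x →ₗ[ℝ] TangentSpace I x :=
    (S.η x : TangentSpace I x →ₗ[ℝ] ℝ).smulRight (S.ξ x)
  let ηAξ : TangentSpace I x →ₗ[ℝ] TangentSpace I x :=
    ((S.η x : TangentSpace I x →ₗ[ℝ] ℝ) ∘ₗ A).smulRight (S.ξ x)
  -- The deformed metric is `g(P ·, ·)` with `P = a + a (a - 1) η ⊗ ξ`; here `ηAξ = (η ⊗ ξ) ∘ A`.
  let Q : TangentSpace I x →ₗ[ℝ] TangentSpace I x :=
    lam x • (a • LinearMap.id + (a * (a - 1)) • ηξ) - (a • A + (a * (a - 1)) • ηAξ)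
      - ((N - 1) * (1 - 1 / a)) • (LinearMap.id - ηξ)
  have hQ (u : TangentSpace I x) : ricci S.g x u u = S.g.inner x (Q u) u := by
    rw [hS.ricci_eq_deform_inner_of_soliton hsol]
    simp only [S.deform_inner, S.transverseMetric_apply, one_div, smul_add, LinearMap.sub_apply,
      LinearMap.add_apply, LinearMap.smul_apply, LinearMap.id_coe, id_eq, LinearMap.coe_smulRight,
      ContinuousLinearMap.coe_coe, LinearMap.coe_comp, Function.comp_apply, map_sub, map_add,
      map_smul, sub_apply, add_apply, smul_apply, smul_eq_mul, ← S.η_eq, Q, ηξ, A, ηAξ, N]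
    ring
  have htrA : LinearMap.trace ℝ (TangentSpace I x) A = divergence (S.deform a ha).g V x := rfl
  have htrηξ : LinearMap.trace ℝ (TangentSpace I x) ηξ = 1 := by
    simp [ηξ, LinearMap.trace_smulRight, S.η_ξ]
  have htrηAξ : LinearMap.trace ℝ (TangentSpace I x) ηAξ
      = dirDeriv S.ξ (fun y ↦ S.η y (V y)) x := by
    simp [ηAξ, A, LinearMap.trace_smulRight, hS.leviCivita_deform_ξ ha hV,
      hS.dirDeriv_ξ_η_apply hV]
  have htrid : LinearMap.trace ℝ (TangentSpace I x) LinearMap.id = N := LinearMap.trace_id ℝ _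
  rw [scal_eq_trace S.g hQ]
  simp only [Q, map_sub, map_add, map_smul, htrA, htrηξ, htrηAξ, htrid,
    hS.soliton_function_eq hsol, smul_eq_mul]
  field_simp
  ring

end AlmostContactMetric.IsTorseForming

end Soliton

end AlmostContact

theorem mainTheorem4_general {E : Type*} [NormedAddCommGroup E] [NormedSpace ℝ E]
    [FiniteDimensional ℝ E] {H : Type*} [TopologicalSpace H] {I : ModelWithCorners ℝ E H}
    {M : Type*} [TopologicalSpace M] [ChartedSpace H M] [IsManifold I ∞ M]
    (S : AlmostContactMetric I M) (hS : S.IsTorseForming) (a : ℝ) (ha : 0 < a)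
    (V : Π x : M, TangentSpace I x) (lam : M → ℝ)
    (hsol : IsAlmostRicciSoliton (S.deform a ha).g V lam) :
    (∀ x : M, lam x
      = dirDeriv S.ξ (fun y ↦ S.η y (V y)) x - (Module.finrank ℝ E - 1) / a ^ 2) ∧
    (∀ (x : M) (X Y : TangentSpace I x),
      ricci S.g x X Y =
        (a * dirDeriv S.ξ (fun y ↦ S.η y (V y)) x - (Module.finrank ℝ E - 1)) * S.g.inner x X Y
        + a * (a - 1) * dirDeriv S.ξ (fun y ↦ S.η y (V y)) x * S.η x X * S.η x Y
        - a / 2 * (S.g.inner x (leviCivita S.g V x X) Y + S.g.inner x (leviCivita S.g V x Y) X)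
        - a * (a - 1) / 2 *
          (S.η x X * (S.η x (leviCivita S.g V x Y) + S.g.inner x Y (V x))
            + S.η x Y * (S.η x (leviCivita S.g V x X) + S.g.inner x X (V x))
            - 2 * S.η x X * S.η x Y * S.η x (V x))) ∧
    (∀ x : M, scal S.g x = Module.finrank ℝ E *
        (a * dirDeriv S.ξ (fun y ↦ S.η y (V y)) x - (Module.finrank ℝ E - 1))
      - a * divergence (S.deform a ha).g V x) := by
  refine ⟨hS.soliton_function_eq hsol, fun x X Y ↦ ?_, hS.scal_eq_of_soliton hsol⟩
  have hV := mdifferentiableAt_of_smoothAt (hsol.smooth_field x)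
  rw [hS.ricci_eq_deform_inner_of_soliton hsol, hS.soliton_function_eq hsol]
  simp only [hS.leviCivita_deform ha hV, S.deform_inner, map_add, map_smul, add_apply, smul_apply,
    smul_eq_mul, S.η_ξ, S.transverseMetric_ξ_left, S.transverseMetric_apply]
  field_simp
  ring

theorem mainTheorem4 (n : ℕ) {M : Type*} [TopologicalSpace M] [T2Space M]
    [SecondCountableTopology M] [ChartedSpace (EuclideanSpace ℝ (Fin (2 * n + 1))) M]
    [IsManifold (𝓡 (2 * n + 1)) ∞ M]
    (S : AlmostContactMetric (𝓡 (2 * n + 1)) M) (hS : S.IsKenmotsu)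
    (a : ℝ) (ha : 0 < a)
    (V : Π x : M, TangentSpace (𝓡 (2 * n + 1)) x) (lam : M → ℝ)
    (hsol : IsAlmostRicciSoliton (S.deform a ha).g V lam)
    (hdiv : ∀ x : M, divergence (S.deform a ha).g V x = 0) :
    (∀ x : M, lam x = dirDeriv S.ξ (fun y ↦ S.η y (V y)) x - 2 * n / a ^ 2) ∧
    (∀ (x : M) (X Y : TangentSpace (𝓡 (2 * n + 1)) x),
      ricci S.g x X Y =
        (a * dirDeriv S.ξ (fun y ↦ S.η y (V y)) x - 2 * n) * S.g.inner x X Y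
        + a * (a - 1) * dirDeriv S.ξ (fun y ↦ S.η y (V y)) x * S.η x X * S.η x Y
        - a / 2 * (S.g.inner x (leviCivita S.g V x X) Y + S.g.inner x (leviCivita S.g V x Y) X)
        - a * (a - 1) / 2 *
          (S.η x X * (S.η x (leviCivita S.g V x Y) + S.g.inner x Y (V x))
            + S.η x Y * (S.η x (leviCivita S.g V x X) + S.g.inner x X (V x))
            - 2 * S.η x X * S.η x Y * S.η x (V x))) ∧
    (∀ x : M, scal S.g x =
      (2 * n + 1) * (a * dirDeriv S.ξ (fun y ↦ S.η y (V y)) x - 2 * n)) := by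
  have hfinrank : (Module.finrank ℝ (EuclideanSpace ℝ (Fin (2 * n + 1))) : ℝ) = 2 * n + 1 := by
    simp
  simpa only [hfinrank, hdiv, mul_zero, sub_zero, add_sub_cancel_right] using
    mainTheorem4_general S hS.isTorseForming a ha V lam hsol
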